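/- \textbf{Conventions.} All metrics are written $d$. Let $\lambda\ge 1$, $k\ge 0$, $E\ge 1$, $C\ge 0$, let $\theta\colon\mathbb R_{\ge0}\to\mathbb R_{\ge0}$ be non-decreasing, and let $\mathcal L$ be a family of $(\lambda,k)$-quasi-geodesic segments $\gamma\colon[0,a]\to X$, i.e. $\lambda^{-1}|t-s|-k\le d(\gamma(t),\gamma(s))\le\lambda|t-s|+k$, in a metric space $X$. The space $X$ is \emph{$(\lambda,k,E,C,\theta,\mathcal L)$-coarsely convex} if (i) any $v,w\in X$ are the initial and the terminal point of some $\gamma\in\mathcal L$; (ii) for all $\gamma\colon[0,a]\to X$ and $\eta\colon[0,b]\to X$ in $\mathcal L$, $t\in[0,a]$, $s\in[0,b]$, $c\in[0,1]$, $$d(\gamma(ct),\eta(cs))\le cE\,d(\gamma(t),\eta(s))+(1-c)E\,d(\gamma(0),\eta(0))+C;$$ (iii) for the same $\gamma,\eta,t,s$, $|t-s|\le\theta\big(d(\gamma(0),\eta(0))+d(\gamma(t),\eta(s))\big)$. \textbf{Boundary.} Let $k_1=\lambda+k$ and $D=2(1+E)k_1+C$, and let $O\in X$. Let $\mathcal L^\infty$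 be the set of maps $\gamma\colon\mathbb R_{\ge 0}\to X$ with $\gamma(t)=\gamma(\lfloor t\rfloor)$ for all $t$ for which there are $\gamma_n\colon[0,a_n]\to X$ in $\mathcal L$ with $a_n\to\infty$, $\gamma_n(0)=\gamma(0)$ and $\gamma_n(m)\to\gamma(m)$ for all $m\in\mathbb N$. Let $\mathcal L_O^\infty$ be the set of $\gamma\in\mathcal L^\infty$ with $\gamma(0)=O$, and $\mathcal L_O$ the set of $\gamma\in\mathcal L$ with $\gamma(0)=O$ and domain $[0,a]$, $a\ge2\theta(0)$. The ideal boundary is $\partial X=\partial_OX:=\mathcal L_O^\infty/{\sim}$, where $\gamma\sim\eta$ iff $\sup_t d(\gamma(t),\eta(t))<\infty$. For $\gamma,\eta\in\mathcal L_O\cup\mathcal L_O^\infty$ put $$(\gamma\mid\eta)_O=\sup\{t\in\operatorname{Dom}\gamma\cap\operatorname{Dom}\eta : d(\gamma(t),\eta(t))\le 2D+2\}.$$ For $x,y\in X\cup\partial_OX$ put $(x\mid y)_O=0$ if $x$ or $y$ is a point of $X$ at distance at most $2\lambda\theta(0)+k$ from $O$, and otherwise let $(x\mid y)_O\in[0,\infty]$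 be the supremum of $(\gamma\mid\eta)_O$ over all $\gamma$ from $O$ to $x$ and $\eta$ from $O$ to $y$; here $\gamma$ is \emph{from $O$ to $x$} if $x\in X$, $\gamma\in\mathcal L_O$ and $\gamma$ ends at $x$, or if $x\in\partial_OX$ and $\gamma\in\mathcal L_O^\infty$ represents $x$. The set $X\cup\partial_OX$ has the topology in which the sets $V_n(x)=\{y:(x,y)\in V_n\}$, $n\ge1$, are a fundamental system of neighbourhoods of $x$, where $$V_n=\{(x,y):(x\mid y)_O>n\}\cup\{(x,y)\in X^2:d(x,y)<1/n\},$$ and $\partial_OX$ has the subspace topology. \textbf{Maps.} Let $X$ and $Y$ be proper metric spaces that are coarsely convex with respect to given data, with $\mathcal L^X$ and $\mathcal L^Y$ the respective families of segments, let $a\in X$ and $b\in Y$ be base points, and let $f\colon X\to Y$ be a map. Call $f$ \emph{visual} if there are $A\ge1$, $B\ge0$ with $d(f(x),f(x'))\le A\,d(x,x')+B$ for all $x,x'\in X$, and $(f(x_n)\mid f(y_n))_b\to\infty$ for all sequences $(x_n),(y_n)$ in $X$ with $(x_n\mid y_n)_a\to\infty$. A \emph{rough contraction} is a non-decreasing map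 $\sigma\colon\mathbb R_{\ge0}\to\mathbb R_{\ge0}$ with $\sigma(0)=0$, $\sigma(t)\to\infty$ as $t\to\infty$, $\sigma(t)\le t$ for all $t$, and, for some $\tau\ge0$, $|\sigma(t)-\sigma(s)|\le|t-s|+\tau$ for all $t,s$. For a rough contraction $\sigma$ and $T>0$, call $f$ \emph{$\sigma$-$T$-$\mathcal L^{X,\infty}_a$-$\mathcal L^{Y,\infty}_b$-equivariant} if $f(a)=b$ and for each $\gamma\in\mathcal L^{X,\infty}_a$ there is $\eta\in\mathcal L^{Y,\infty}_b$ with $d(f(\gamma(t)),\eta(\sigma(t)))<T$ for all $t\ge0$. Call $f$ a \emph{coarse embedding} if there are non-decreasing $\psi,\psi'\colon\mathbb R_{\ge0}\to\mathbb R_{\ge0}$ with $\psi'(t)\to\infty$ as $t\to\infty$ and $\psi'(d(x,x'))\le d(f(x),f(x'))\le\psi(d(x,x'))$ for all $x,x'$, and \emph{coarsely surjective} if $Y$ is the $C_0$-neighbourhood of $f(X)$ for some $C_0\ge0$. \textbf{Corollary.} Let $f\colon X\to Y$ be a visual coarse embedding that is $\sigma$-$T$-$\mathcal L^{X,\infty}_a$-$\mathcal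 L^{Y,\infty}_b$-equivariant for a rough contraction $\sigma$ and some $T>0$. Then there is exactly one map $\partial f\colon\partial_aX\to\partial_bY$ induced by $f$, i.e. such that $f(\gamma(n))\to\partial f([\gamma])$ in $Y\cup\partial_bY$ as $n\to\infty$ for every $\gamma\in\mathcal L^{X,\infty}_a$, and $\partial f$ is a topological embedding. If moreover $f$ is coarsely surjective, then $\partial f$ is a homeomorphism. -/

import Mathlib

open Filter Topology
open scoped NNReal ENNReal

namespace CoarseConvex

/-! ## Maps between metric spaces -/

section Maps

variable {X Y : Type*} [MetricSpace X] [MetricSpace Y]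

/-- `f` is bornologous. -/
def Bornologous (f : X → Y) : Prop :=
  ∃ ψ : ℝ≥0 → ℝ≥0, Monotone ψ ∧ ∀ x x' : X, nndist (f x) (f x') ≤ ψ (nndist x x')

/-- `f` is `(A, B)`-large scale Lipschitz for some `A ≥ 1` and `B ≥ 0`. -/
def LargeScaleLipschitz (f : X → Y) : Prop :=
  ∃ A B : ℝ, 1 ≤ A ∧ 0 ≤ B ∧ ∀ x x' : X, dist (f x) (f x') ≤ A * dist x x' + B

/-- `f` is a coarse embedding. -/
def CoarseEmbedding (f : X → Y) : Prop :=
  Bornologous f ∧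
    ∃ ψ : ℝ≥0 → ℝ≥0, Monotone ψ ∧ Tendsto ψ atTop atTop ∧
      ∀ x x' : X, ψ (nndist x x') ≤ nndist (f x) (f x')

/-- `f` is coarsely surjective. -/
def CoarselySurjective (f : X → Y) : Prop :=
  ∃ C : ℝ, 0 ≤ C ∧ ∀ y : Y, ∃ x : X, dist (f x) y ≤ C

/-- `ρ` is a rough contraction, that is, a `τ`-rough contraction for some `τ ≥ 0`. -/
def RoughContraction (ρ : ℝ≥0 → ℝ≥0) : Prop :=
  ∃ τ : ℝ, 0 ≤ τ ∧ ρ 0 = 0 ∧ Tendsto ρ atTop atTop ∧ (∀ t, ρ t ≤ t) ∧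
    (∀ t s, |(ρ t : ℝ) - ρ s| ≤ |(t : ℝ) - s| + τ) ∧ Monotone ρ

end Maps

/-- The restriction of `γ` to `[0, a]` is a `(lam, k)`-quasi-geodesic segment. -/
def IsQuasiGeodesicSegment {X : Type*} [MetricSpace X] (lam k : ℝ) (a : ℝ≥0) (γ : ℝ≥0 → X) :
    Prop :=
  ∀ t s : ℝ≥0, t ≤ a → s ≤ a →
    lam⁻¹ * |(t : ℝ) - s| - k ≤ dist (γ t) (γ s) ∧
      dist (γ t) (γ s) ≤ lam * |(t : ℝ) - s| + k

/-- The data and axioms of a `(lam, k, E, C, θ, L)`-coarsely convex space. A segment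
`γ : [0, a] → X` is recorded as a pair `(a, γ)`; only the values of `γ` on `[0, a]` are used. -/
structure CoarselyConvexSpace (X : Type*) [MetricSpace X] where
  lam : ℝ
  k : ℝ
  E : ℝ
  C : ℝ
  θ : ℝ≥0 → ℝ≥0
  /-- the system of good quasi-geodesic segments -/
  L : Set (ℝ≥0 × (ℝ≥0 → X))
  one_le_lam : 1 ≤ lam
  k_nonneg : 0 ≤ k
  one_le_E : 1 ≤ E
  C_nonneg : 0 ≤ C
  θ_mono : Monotone θ
  quasiGeodesic : ∀ a γ, (a, γ) ∈ L → IsQuasiGeodesicSegment lam k a γ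
  connected : ∀ v w : X, ∃ a γ, (a, γ) ∈ L ∧ γ 0 = v ∧ γ a = w
  convex : ∀ a γ b η, (a, γ) ∈ L → (b, η) ∈ L →
    ∀ t s c : ℝ≥0, t ≤ a → s ≤ b → c ≤ 1 →
      dist (γ (c * t)) (η (c * s)) ≤
        c * E * dist (γ t) (η s) + (1 - (c : ℝ)) * E * dist (γ 0) (η 0) + C
  param_regular : ∀ a γ b η, (a, γ) ∈ L → (b, η) ∈ L →
    ∀ t s : ℝ≥0, t ≤ a → s ≤ b →
      |(t : ℝ) - s| ≤ θ (nndist (γ 0) (η 0) + nndist (γ t) (η s))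

namespace CoarselyConvexSpace

variable {X : Type*} [MetricSpace X] (S : CoarselyConvexSpace X) (O : X)

/-- The constant `k₁ = lam + k`. -/
def k₁ : ℝ := S.lam + S.k

/-- The constant `D = 2 (1 + E) k₁ + C`. -/
def D : ℝ := 2 * (1 + S.E) * S.k₁ + S.C

/-- `γ` is `L`-approximatable. -/
def Approximatable (γ : ℝ≥0 → X) : Prop :=
  ∃ (a : ℕ → ℝ≥0) (g : ℕ → ℝ≥0 → X), Tendsto a atTop atTop ∧
    (∀ n, (a n, g n) ∈ S.L ∧ g n 0 = γ 0) ∧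
    ∀ m : ℕ, Tendsto (fun n => g n m) atTop (𝓝 (γ m))

/-- The family `L^∞` of quasi-geodesic rays. -/
def rays : Set (ℝ≥0 → X) :=
  {γ | S.Approximatable γ ∧ ∀ t : ℝ≥0, γ t = γ (⌊t⌋₊ : ℝ≥0)}

/-- The family `L_O^∞` of the rays in `L^∞` that start at `O`. -/
structure Ray where
  toFun : ℝ≥0 → X
  mem_rays : toFun ∈ S.rays
  base : toFun 0 = O

instance : CoeFun (S.Ray O) (fun _ => ℝ≥0 → X) := ⟨Ray.toFun⟩

/-- Two rays are equivalent if they are at bounded distance of each other. -/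
def raySetoid : Setoid (S.Ray O) where
  r γ η := BddAbove (Set.range fun t : ℝ≥0 => dist (γ t) (η t))
  iseqv :=
    { refl := fun γ => ⟨0, by rintro _ ⟨t, rfl⟩; simp⟩
      symm := by
        rintro γ η ⟨M, hM⟩
        refine ⟨M, ?_⟩
        rintro _ ⟨t, rfl⟩
        exact (dist_comm _ _).trans_le (hM ⟨t, rfl⟩)
      trans := by
        rintro γ η ξ ⟨M, hM⟩ ⟨N, hN⟩
        refine ⟨M + N, ?_⟩
        rintro _ ⟨t, rfl⟩
        exact (dist_triangle _ (η t) _).trans (add_le_add (hM ⟨t, rfl⟩) (hN ⟨t, rfl⟩)) }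

/-- The ideal boundary `∂_O X` with respect to the base point `O`. -/
def Boundary : Type _ := Quotient (S.raySetoid O)

/-- The class of a ray in the ideal boundary. -/
def toBoundary (γ : S.Ray O) : S.Boundary O := Quotient.mk (S.raySetoid O) γ

/-- The disjoint union `X ∪ ∂_O X`. -/
inductive Bordification : Type _
  | pt (x : X) : Bordification
  | bd (ξ : S.Boundary O) : Bordification

variable {S O}

/-- The point lies in the closed ball of radius `2 lam θ(0) + k` around `O`. -/
def Bordification.Near : S.Bordification O → Prop
  | .pt x => dist O x ≤ 2 * S.lam * S.θ 0 + S.k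
  | .bd _ => False

/-- The set of good quasi-geodesics from `O` to a point `x` of `X ∪ ∂_O X`; each is recorded as
its domain together with the map. -/
def Bordification.arcs : S.Bordification O → Set (Set ℝ≥0 × (ℝ≥0 → X))
  | .pt x => {α | ∃ a γ, (a, γ) ∈ S.L ∧ 2 * S.θ 0 ≤ a ∧ γ 0 = O ∧ γ a = x ∧ α = (Set.Iic a, γ)}
  | .bd ξ => {α | ∃ γ : S.Ray O, S.toBoundary O γ = ξ ∧ α = (Set.univ, γ.toFun)}

variable (S)

/-- The product `(γ ∣ η)_O` of two good quasi-geodesics starting at `O`. -/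
noncomputable def arcProd (α β : Set ℝ≥0 × (ℝ≥0 → X)) : ℝ≥0∞ :=
  ⨆ (t : ℝ≥0) (_ : t ∈ α.1 ∩ β.1 ∧ dist (α.2 t) (β.2 t) ≤ 2 * S.D + 2), (t : ℝ≥0∞)

variable {S}

open scoped Classical in
/-- The product `(x ∣ y)_O` on `X ∪ ∂_O X`. -/
noncomputable def gromovProd (p q : S.Bordification O) : ℝ≥0∞ :=
  if p.Near ∨ q.Near then 0 else ⨆ (α ∈ p.arcs) (β ∈ q.arcs), S.arcProd α β

/-- The relation `V_n` on `X ∪ ∂_O X`, used for `n ≥ 1`. -/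
def entourage (n : ℕ) : Set (S.Bordification O × S.Bordification O) :=
  {p | (n : ℝ≥0∞) < gromovProd p.1 p.2} ∪
    {p | ∃ x y : X, p = (.pt x, .pt y) ∧ dist x y < (n : ℝ)⁻¹}

theorem entourage_anti {m n : ℕ} (hm : 0 < m) (h : m ≤ n) :
    (entourage n : Set (S.Bordification O × S.Bordification O)) ⊆ entourage m := by
  rintro p (hp | ⟨x, y, rfl, hxy⟩)
  · exact Or.inl (lt_of_le_of_lt (b := (n : ℝ≥0∞)) (by exact_mod_cast h) hp)
  · refine Or.inr ⟨x, y, rfl, hxy.trans_le ?_⟩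
    gcongr

/-- The topology on `X ∪ ∂_O X`, with the sets `V_n(p)`, `n ≥ 1`, as fundamental neighbourhoods
of the point `p`. -/
instance : TopologicalSpace (S.Bordification O) where
  IsOpen U := ∀ p ∈ U, ∃ n : ℕ, 0 < n ∧ ∀ q, (p, q) ∈ entourage n → q ∈ U
  isOpen_univ := fun _ _ => ⟨1, one_pos, fun _ _ => trivial⟩
  isOpen_inter := by
    rintro U V hU hV p ⟨hpU, hpV⟩
    obtain ⟨m, hm, h⟩ := hU p hpU
    obtain ⟨n, hn, h'⟩ := hV p hpV
    exact ⟨max m n, lt_max_of_lt_left hm, fun q hq =>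
      ⟨h q (entourage_anti hm (le_max_left _ _) hq),
        h' q (entourage_anti hn (le_max_right _ _) hq)⟩⟩
  isOpen_sUnion := by
    rintro 𝒰 h𝒰 p ⟨U, hU, hp⟩
    obtain ⟨n, hn, h⟩ := h𝒰 U hU p hp
    exact ⟨n, hn, fun q hq => ⟨U, hU, h q hq⟩⟩

/-- The ideal boundary carries the subspace topology from `X ∪ ∂_O X`. -/
instance : TopologicalSpace (S.Boundary O) :=
  TopologicalSpace.induced (Bordification.bd (S := S) (O := O)) inferInstance

end CoarselyConvexSpace

open CoarselyConvexSpace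

variable {X Y : Type*} [MetricSpace X] [MetricSpace Y]

/-- `f` is a visual map, with respect to the base points `a` and `b`. -/
def Visual (SX : CoarselyConvexSpace X) (SY : CoarselyConvexSpace Y) (a : X) (b : Y)
    (f : X → Y) : Prop :=
  LargeScaleLipschitz f ∧
    ∀ x y : ℕ → X,
      Tendsto (fun n => gromovProd (S := SX) (O := a) (.pt (x n)) (.pt (y n))) atTop (𝓝 ⊤) →
      Tendsto (fun n => gromovProd (S := SY) (O := b) (.pt (f (x n))) (.pt (f (y n)))) atTop (𝓝 ⊤)

/-- `f` is `ρ`-`T`-`L_a^∞`-`L_b^∞`-equivariant. -/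
def RayEquivariant (SX : CoarselyConvexSpace X) (SY : CoarselyConvexSpace Y) (a : X) (b : Y)
    (ρ : ℝ≥0 → ℝ≥0) (T : ℝ) (f : X → Y) : Prop :=
  f a = b ∧ ∀ γ : SX.Ray a, ∃ η : SY.Ray b, ∀ t : ℝ≥0, dist (f (γ t)) (η (ρ t)) < T

/-- `F : ∂_a X → ∂_b Y` is the map induced by `f`: for every ray `γ` starting at `a`, the points
`f (γ n)` converge to `F [γ]` in `Y ∪ ∂_b Y`. -/
def IsInducedBy (SX : CoarselyConvexSpace X) (SY : CoarselyConvexSpace Y) (a : X) (b : Y)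
    (f : X → Y) (F : SX.Boundary a → SY.Boundary b) : Prop :=
  ∀ γ : SX.Ray a,
    Tendsto (fun n : ℕ => (Bordification.pt (f (γ n)) : SY.Bordification b)) atTop
      (𝓝 (Bordification.bd (F (SX.toBoundary a γ))))

end CoarseConvex

namespace CoarseConvex

namespace CoarselyConvexSpace

variable {X : Type*} [MetricSpace X] (S : CoarselyConvexSpace X) (O : X)

/-! Call the ray `η γ` in `Y` that follows `f ∘ γ` at times `σ t` the shadow of `γ`; the induced map
sends `[γ]` to `[η γ]`. The argument rests on one dictionary: up to constants, `(p ∣ q)` is large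
exactly when some paths from `O` to `p` and to `q` are boundedly close at some large times. One
direction is `exists_of_lt_gromovProd`. The other is `exists_lt_gromovProd`: convexity from a common
base point contracts a gap `K` at time `M` to at most `c E K + D` at time `c M`, and this falls
below `2D + 2` for small `c`. The coarse ultrametric inequality follows, and with it the description
of neighbourhoods and the uniqueness of limits in the boundary.

Since `f` is large scale Lipschitz, close rays have close shadows; since `f` is a coarse embedding,
close shadows come from close rays. As `σ` tends to infinity and `σ t ≤ t`, large products
correspond in both directions (`exists_lt_gromovProd_shadow`, `exists_lt_gromovProd_of_shadow`), so
the induced map is an embedding.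

For surjectivity (`exists_ray_shadow_eq`), points of a ray `ζ` in `Y` are pulled back coarsely to
`X`, and properness gives a limit ray `γ` of the segments from `a` to them. Visuality carries the
large products along these segments to `Y`, which forces `[η γ] = [ζ]`. -/

theorem lam_pos : 0 < S.lam := one_pos.trans_le S.one_le_lam

theorem k₁_nonneg : 0 ≤ S.k₁ := add_nonneg S.lam_pos.le S.k_nonneg

theorem E_pos : 0 < S.E := one_pos.trans_le S.one_le_E

theorem two_k₁_add_C_le_D : 2 * S.k₁ + S.C ≤ S.D := by
  have := mul_nonneg S.E_pos.le S.k₁_nonneg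
  unfold D
  nlinarith

theorem D_nonneg : 0 ≤ S.D :=
  (add_nonneg (mul_nonneg two_pos.le S.k₁_nonneg) S.C_nonneg).trans S.two_k₁_add_C_le_D

/-- A path starting at `O` which, up to rounding times down by at most one, is approximated on
bounded sets of times by the good segments starting at `O`. -/
structure IsGoodPath (α : Set ℝ≥0 × (ℝ≥0 → X)) : Prop where
  map_zero : α.2 0 = O
  isLowerSet : IsLowerSet α.1
  approx : ∃ r : ℝ≥0 → ℝ≥0, (∀ t, r t ≤ t) ∧ (∀ t, t ≤ r t + 1) ∧
    ∀ T : ℝ≥0, ∀ ε : ℝ, 0 < ε → ∃ a g, (a, g) ∈ S.L ∧ g 0 = O ∧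
      ∀ t ∈ α.1, t ≤ T → r t ≤ a ∧ dist (α.2 t) (g (r t)) ≤ ε

variable {S O}

theorem isGoodPath_segment {a : ℝ≥0} {γ : ℝ≥0 → X} (h : (a, γ) ∈ S.L) (h0 : γ 0 = O) :
    S.IsGoodPath O (Set.Iic a, γ) where
  map_zero := h0
  isLowerSet := isLowerSet_Iic a
  approx := ⟨id, fun _ => le_rfl, fun _ => le_self_add, fun _ ε hε =>
    ⟨a, γ, h, h0, fun t ht _ => ⟨ht, by simpa using hε.le⟩⟩⟩

theorem isGoodPath_ray (γ : S.Ray O) : S.IsGoodPath O (Set.univ, γ.toFun) where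
  map_zero := γ.base
  isLowerSet := isLowerSet_univ
  approx := by
    obtain ⟨⟨a, g, ha, hg, hlim⟩, hfl⟩ := γ.mem_rays
    refine ⟨fun t => (⌊t⌋₊ : ℝ≥0), fun t => Nat.floor_le zero_le,
      fun t => (Nat.lt_floor_add_one t).le, fun T ε hε => ?_⟩
    have h1 : ∀ᶠ n in atTop, ∀ m ∈ Set.Iic ⌊T⌋₊, dist (g n (m : ℝ≥0)) (γ (m : ℝ≥0)) < ε :=
      (eventually_all_finite (Set.finite_Iic _)).2 fun m _ =>
        Metric.tendsto_nhds.1 (hlim m) ε hε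
    obtain ⟨n, hn, hn'⟩ := (h1.and (ha.eventually_ge_atTop T)).exists
    refine ⟨a n, g n, (hg n).1, (hg n).2.trans γ.base, fun t _ ht =>
      ⟨(Nat.floor_le zero_le).trans (ht.trans hn'), ?_⟩⟩
    have := hn ⌊t⌋₊ (Nat.floor_mono ht)
    rw [dist_comm] at this
    exact (congrArg (fun z => dist z _) (hfl t)).trans_le this.le

/-! ### Metric estimates for good paths. -/

namespace IsGoodPath

variable {α β : Set ℝ≥0 × (ℝ≥0 → X)}

/-- Rounding changes a time difference by at most 1. This costs at most `lam`, which turns `k` into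
`k₁ = lam + k`. -/
theorem dist_le (hα : S.IsGoodPath O α) {t s : ℝ≥0} (ht : t ∈ α.1) (hs : s ∈ α.1) :
    dist (α.2 t) (α.2 s) ≤ S.lam * |(t : ℝ) - s| + S.k₁ := by
  obtain ⟨r, hr, hr', happ⟩ := hα.approx
  refine le_of_forall_pos_le_add fun ε hε => ?_
  obtain ⟨a, g, hg, -, h⟩ := happ (max t s) (ε / 2) (by positivity)
  obtain ⟨ha, h1⟩ := h t ht (le_max_left _ _)
  obtain ⟨ha', h2⟩ := h s hs (le_max_right _ _)
  have h3 := (S.quasiGeodesic a g hg _ _ ha ha').2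
  have h4 : |(r t : ℝ) - r s| ≤ |(t : ℝ) - s| + 1 := by
    have e1 : (r t : ℝ) ≤ t := hr t
    have e2 : (r s : ℝ) ≤ s := hr s
    have e3 : (t : ℝ) ≤ r t + 1 := by exact_mod_cast hr' t
    have e4 : (s : ℝ) ≤ r s + 1 := by exact_mod_cast hr' s
    rw [abs_le]
    constructor <;> linarith [le_abs_self ((t : ℝ) - s), neg_abs_le ((t : ℝ) - s)]
  have h5 := mul_le_mul_of_nonneg_left h4 S.lam_pos.le
  have h6 := dist_triangle4_right (α.2 t) (α.2 s) (g (r t)) (g (r s))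
  unfold k₁
  linarith

theorem le_dist (hα : S.IsGoodPath O α) {t s : ℝ≥0} (ht : t ∈ α.1) (hs : s ∈ α.1) :
    S.lam⁻¹ * |(t : ℝ) - s| - S.k₁ ≤ dist (α.2 t) (α.2 s) := by
  obtain ⟨r, hr, hr', happ⟩ := hα.approx
  refine le_of_forall_pos_le_add fun ε hε => ?_
  obtain ⟨a, g, hg, -, h⟩ := happ (max t s) (ε / 2) (by positivity)
  obtain ⟨ha, h1⟩ := h t ht (le_max_left _ _)
  obtain ⟨ha', h2⟩ := h s hs (le_max_right _ _)
  have h3 := (S.quasiGeodesic a g hg _ _ ha ha').1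
  have h4 : |(t : ℝ) - s| ≤ |(r t : ℝ) - r s| + 1 := by
    have e1 : (r t : ℝ) ≤ t := hr t
    have e2 : (r s : ℝ) ≤ s := hr s
    have e3 : (t : ℝ) ≤ r t + 1 := by exact_mod_cast hr' t
    have e4 : (s : ℝ) ≤ r s + 1 := by exact_mod_cast hr' s
    rw [abs_le]
    constructor <;> linarith [le_abs_self ((r t : ℝ) - r s), neg_abs_le ((r t : ℝ) - r s)]
  have h5 := mul_le_mul_of_nonneg_left h4 (inv_pos.2 S.lam_pos).le
  have h6 := dist_triangle4 (g (r t)) (α.2 t) (α.2 s) (g (r s))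
  have h7 : S.lam⁻¹ ≤ S.lam := (inv_le_one_of_one_le₀ S.one_le_lam).trans S.one_le_lam
  rw [dist_comm] at h1
  unfold k₁
  linarith

/-- The approximating segments share their base point, so the `1 - c` term of convexity vanishes.
Rounding does not commute with scaling by `c`, but the error in time is at most 1, costing `k₁` on
each path; `2 k₁ + C ≤ D` absorbs this. -/
theorem dist_mul_le (hα : S.IsGoodPath O α) (hβ : S.IsGoodPath O β) {t s c : ℝ≥0}
    (ht : t ∈ α.1) (hs : s ∈ β.1) (hc : c ≤ 1) :
    dist (α.2 (c * t)) (β.2 (c * s)) ≤ c * S.E * dist (α.2 t) (β.2 s) + S.D := by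
  obtain ⟨r, hr, hr', happ⟩ := hα.approx
  obtain ⟨q, hq, hq', happ'⟩ := hβ.approx
  have hc' : (c : ℝ) ≤ 1 := hc
  have hE := S.E_pos
  have close : ∀ (r : ℝ≥0 → ℝ≥0), (∀ t, r t ≤ t) → (∀ t, t ≤ r t + 1) → ∀ t : ℝ≥0,
      |(r (c * t) : ℝ) - (c * r t : ℝ≥0)| ≤ 1 := by
    intro r hr hr' t
    have e1 : (r t : ℝ) ≤ t := hr t
    have e3 : (t : ℝ) ≤ r t + 1 := by exact_mod_cast hr' t
    have e2 : (r (c * t) : ℝ) ≤ c * t := by exact_mod_cast hr (c * t)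
    have e4 : (c * t : ℝ) ≤ r (c * t) + 1 := by exact_mod_cast hr' (c * t)
    have e5 := mul_le_mul_of_nonneg_left e1 c.coe_nonneg
    have e6 := mul_le_mul_of_nonneg_left e3 c.coe_nonneg
    push_cast
    rw [abs_le]
    constructor <;> linarith
  refine le_of_forall_pos_le_add fun ε hε => ?_
  -- An error `2 δ` arises at the scaled times, and another `2 δ`, multiplied by at most `E`, at the
  -- original times.
  set δ := ε / (2 + 2 * S.E) with hδ
  have hδ0 : 0 < δ := by positivity
  have hδε : 2 * δ + S.E * (2 * δ) = ε := by rw [hδ]; field_simp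
  obtain ⟨a, g, hg, g0, h⟩ := happ t δ hδ0
  obtain ⟨b, e, he, e0, h'⟩ := happ' s δ hδ0
  have hct : c * t ≤ t := mul_le_of_le_one_left zero_le hc
  have hcs : c * s ≤ s := mul_le_of_le_one_left zero_le hc
  obtain ⟨a1, d1⟩ := h t ht le_rfl
  obtain ⟨a2, d2⟩ := h (c * t) (hα.isLowerSet hct ht) hct
  obtain ⟨a3, d3⟩ := h' s hs le_rfl
  obtain ⟨a4, d4⟩ := h' (c * s) (hβ.isLowerSet hcs hs) hcs
  have q1 := (S.quasiGeodesic a g hg _ (c * r t) a2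
    ((mul_le_of_le_one_left zero_le hc).trans a1)).2
  have q2 := (S.quasiGeodesic b e he _ (c * q s) a4
    ((mul_le_of_le_one_left zero_le hc).trans a3)).2
  have q3 := mul_le_mul_of_nonneg_left (close r hr hr' t) S.lam_pos.le
  have q4 := mul_le_mul_of_nonneg_left (close q hq hq' s) S.lam_pos.le
  have cv := S.convex a g b e hg he (r t) (q s) c a1 a3 hc
  rw [g0, e0, dist_self, mul_zero, add_zero] at cv
  have w1 : dist (g (r t)) (e (q s)) ≤ dist (α.2 t) (β.2 s) + 2 * δ := by
    have := dist_triangle4_left (α.2 t) (β.2 s) (g (r t)) (e (q s))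
    linarith
  have w2 := mul_le_mul_of_nonneg_left w1 (mul_nonneg c.coe_nonneg hE.le)
  have w3 : (c : ℝ) * S.E * (2 * δ) ≤ S.E * (2 * δ) := by
    have := mul_le_mul_of_nonneg_right hc' (mul_nonneg hE.le (by positivity : 0 ≤ 2 * δ))
    linarith
  have w4 := dist_triangle4_right (α.2 (c * t)) (β.2 (c * s)) (g (r (c * t))) (e (q (c * s)))
  have w5 := dist_triangle4_right (g (r (c * t))) (e (q (c * s))) (g (c * r t)) (e (c * q s))
  have w6 := S.two_k₁_add_C_le_D
  unfold k₁ at w6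
  linarith

/-- Approximating each path within `1/2` enlarges the distance bound by 1; rounding the times
accounts for the other 1. -/
theorem abs_sub_le (hα : S.IsGoodPath O α) (hβ : S.IsGoodPath O β) {t s R : ℝ≥0}
    (ht : t ∈ α.1) (hs : s ∈ β.1) (hR : nndist (α.2 t) (β.2 s) ≤ R) :
    |(t : ℝ) - s| ≤ S.θ (R + 1) + 1 := by
  obtain ⟨r, hr, hr', happ⟩ := hα.approx
  obtain ⟨q, hq, hq', happ'⟩ := hβ.approx
  obtain ⟨a, g, hg, g0, h⟩ := happ t (1 / 2) (by norm_num)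
  obtain ⟨b, e, he, e0, h'⟩ := happ' s (1 / 2) (by norm_num)
  obtain ⟨a1, d1⟩ := h t ht le_rfl
  obtain ⟨a3, d3⟩ := h' s hs le_rfl
  have h1 := S.param_regular a g b e hg he _ _ a1 a3
  have h2 : nndist (g 0) (e 0) + nndist (g (r t)) (e (q s)) ≤ R + 1 := by
    rw [g0, e0, nndist_self, zero_add, ← NNReal.coe_le_coe, coe_nndist]
    have h3 : dist (α.2 t) (β.2 s) ≤ R := hR
    have := dist_triangle4_left (α.2 t) (β.2 s) (g (r t)) (e (q s))
    push_cast
    linarith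
  have h3 : (S.θ (nndist (g 0) (e 0) + nndist (g (r t)) (e (q s))) : ℝ) ≤ S.θ (R + 1) :=
    S.θ_mono h2
  have e1 : (r t : ℝ) ≤ t := hr t
  have e2 : (q s : ℝ) ≤ s := hq s
  have e3 : (t : ℝ) ≤ r t + 1 := by exact_mod_cast hr' t
  have e4 : (s : ℝ) ≤ q s + 1 := by exact_mod_cast hq' s
  have h4 := abs_le.1 h1
  rw [abs_le]
  constructor <;> linarith [h4.1, h4.2]

theorem dist_le_mul_add (hα : S.IsGoodPath O α) (hβ : S.IsGoodPath O β) {t u : ℝ≥0}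
    (ht : t ∈ α.1) (ht' : t ∈ β.1) (hu : u ≤ t) :
    dist (α.2 u) (β.2 u) ≤ S.E * dist (α.2 t) (β.2 t) + S.D := by
  have hc : u / t ≤ 1 := div_le_one_of_le₀ hu zero_le
  have hut : u / t * t = u := by
    rcases eq_or_ne t 0 with rfl | h
    · simpa using hu.antisymm zero_le |>.symm
    · exact div_mul_cancel₀ u h
  have h := hα.dist_mul_le hβ ht ht' hc
  rw [hut] at h
  have hc' : ((u / t : ℝ≥0) : ℝ) ≤ 1 := hc
  have := mul_le_mul_of_nonneg_right hc'
    (mul_nonneg S.E_pos.le (dist_nonneg (x := α.2 t) (y := β.2 t)))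
  linarith

end IsGoodPath

/-! ### Fellow travelling and large products. -/

variable (S) in
/-- Two good paths that come close to each other stay close up to that time. -/
theorem exists_fellow_travel_bound (R : ℝ) :
    ∃ K : ℝ, ∀ (O : X) (α β : Set ℝ≥0 × (ℝ≥0 → X)), S.IsGoodPath O α → S.IsGoodPath O β →
      ∀ t ∈ α.1, ∀ s ∈ β.1, dist (α.2 t) (β.2 s) ≤ R → ∀ u ≤ t, u ≤ s →
        dist (α.2 u) (β.2 u) ≤ K := by
  -- The number `e` bounds `|t - s|`. Both paths can thus be moved to the common time `min t s` at
  -- bounded cost, and convexity handles all earlier times.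
  set e : ℝ := S.θ (R.toNNReal + 1) + 1 with he
  refine ⟨S.E * (R + 2 * (S.lam * e + S.k₁)) + S.D,
    fun O α β hα hβ t ht s hs hR u hut hus => ?_⟩
  have hts : |(t : ℝ) - s| ≤ e :=
    hα.abs_sub_le hβ ht hs (NNReal.le_toNNReal_of_coe_le (by simpa using hR))
  have hm1 := hα.isLowerSet (min_le_left t s) ht
  have hm2 := hβ.isLowerSet (min_le_right t s) hs
  have h1 := hα.dist_le_mul_add hβ hm1 hm2 (le_min hut hus)
  have h2 := hα.dist_le hm1 ht
  have h3 := hβ.dist_le hm2 hs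
  have h4 := abs_le.1 hts
  have hmt : |((min t s : ℝ≥0) : ℝ) - t| ≤ e := by
    rw [NNReal.coe_min, abs_le]
    rcases le_total (t : ℝ) s with h | h <;> simp only [h, min_eq_left, min_eq_right] <;>
      constructor <;> linarith [h4.1, h4.2]
  have hms : |((min t s : ℝ≥0) : ℝ) - s| ≤ e := by
    rw [NNReal.coe_min, abs_le]
    rcases le_total (t : ℝ) s with h | h <;> simp only [h, min_eq_left, min_eq_right] <;>
      constructor <;> linarith [h4.1, h4.2]
  have h5 := mul_le_mul_of_nonneg_left hmt S.lam_pos.le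
  have h6 := mul_le_mul_of_nonneg_left hms S.lam_pos.le
  have h7 := dist_triangle4_right (α.2 (min t s)) (β.2 (min t s)) (α.2 t) (β.2 s)
  have h8 := mul_le_mul_of_nonneg_left
    (show dist (α.2 (min t s)) (β.2 (min t s)) ≤ R + 2 * (S.lam * e + S.k₁) by linarith) S.E_pos.le
  linarith

variable (S) in
/-- Two good paths that are close at large times have a large product. -/
theorem exists_lt_arcProd (R : ℝ) (N : ℕ) :
    ∃ M : ℕ, ∀ (O : X) (α β : Set ℝ≥0 × (ℝ≥0 → X)), S.IsGoodPath O α → S.IsGoodPath O β →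
      ∀ t ∈ α.1, ∀ s ∈ β.1, dist (α.2 t) (β.2 s) ≤ R → (M : ℝ≥0) ≤ t → (M : ℝ≥0) ≤ s →
        (N : ℝ≥0∞) < S.arcProd α β := by
  obtain ⟨K, hK⟩ := S.exists_fellow_travel_bound R
  -- Scaling from time `M` down to `N + 1` leaves at most `(N + 1) / M * E * K ≤ 1` besides `D`. The
  -- `max` with 1 ensures `N + 1 ≤ M`, and time `N + 1` gives the strict inequality.
  obtain ⟨M, hM⟩ := exists_nat_ge ((N + 1 : ℝ) * max 1 (S.E * K))
  have hmax : (0 : ℝ) < max 1 (S.E * K) := one_pos.trans_le (le_max_left _ _)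
  have hM0 : (0 : ℝ) < M := lt_of_lt_of_le (by positivity) hM
  refine ⟨M, fun O α β hα hβ t ht s hs hR hMt hMs => ?_⟩
  have h1 := hK O α β hα hβ t ht s hs hR M hMt hMs
  have hc : ((N + 1 : ℕ) : ℝ≥0) / M ≤ 1 := by
    refine div_le_one_of_le₀ ?_ zero_le
    rw [← NNReal.coe_le_coe]
    push_cast
    have := le_mul_of_one_le_right (by positivity : (0 : ℝ) ≤ N + 1) (le_max_left 1 (S.E * K))
    linarith
  have h2 := hα.dist_mul_le hβ (hα.isLowerSet hMt ht) (hβ.isLowerSet hMs hs) hc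
  have hM0' : (M : ℝ≥0) ≠ 0 := by exact_mod_cast hM0.ne'
  rw [div_mul_cancel₀ _ hM0'] at h2
  have hNM : ((N + 1 : ℕ) : ℝ≥0) ≤ M := by
    rwa [div_le_one (by positivity)] at hc
  have h3 : dist (α.2 ((N + 1 : ℕ) : ℝ≥0)) (β.2 ((N + 1 : ℕ) : ℝ≥0)) ≤ 2 * S.D + 2 := by
    refine h2.trans ?_
    have h4 : (N + 1 : ℝ) / M * (S.E * K) ≤ 1 := by
      rw [div_mul_eq_mul_div, div_le_one hM0]
      exact (mul_le_mul_of_nonneg_left (le_max_right _ _) (by positivity)).trans hM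
    have h5 := mul_le_mul_of_nonneg_left h1
      (by have := S.E_pos; positivity : 0 ≤ (N + 1 : ℝ) / M * S.E)
    push_cast at h5 ⊢
    linarith [S.D_nonneg]
  refine lt_of_lt_of_le (b := (((N + 1 : ℕ) : ℝ≥0) : ℝ≥0∞)) (by norm_cast; omega) ?_
  exact le_iSup₂_of_le (f := fun (t : ℝ≥0) (_ : t ∈ α.1 ∩ β.1 ∧
    dist (α.2 t) (β.2 t) ≤ 2 * S.D + 2) => (t : ℝ≥0∞)) _
    ⟨⟨hα.isLowerSet (hNM.trans hMt) ht, hβ.isLowerSet (hNM.trans hMs) hs⟩, h3⟩ le_rfl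

/-! ### Paths from the base point to points of the bordification -/

/-- `α` is a good path from `O` to the point `p` of `X ∪ ∂_O X`, of arbitrary length. -/
def Bordification.IsPathTo : S.Bordification O → Set ℝ≥0 × (ℝ≥0 → X) → Prop
  | .pt x, α => ∃ a γ, (a, γ) ∈ S.L ∧ γ 0 = O ∧ γ a = x ∧ α = (Set.Iic a, γ)
  | .bd ξ, α => ∃ γ : S.Ray O, S.toBoundary O γ = ξ ∧ α = (Set.univ, γ.toFun)

namespace Bordification

variable {p : S.Bordification O} {α β : Set ℝ≥0 × (ℝ≥0 → X)}

theorem isPathTo_of_mem_arcs (h : α ∈ p.arcs) : p.IsPathTo α := by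
  cases p with
  | pt x =>
    obtain ⟨a, γ, h1, -, h2⟩ := h
    exact ⟨a, γ, h1, h2⟩
  | bd ξ => exact h

theorem IsPathTo.isGoodPath (h : p.IsPathTo α) : S.IsGoodPath O α := by
  cases p with
  | pt x =>
    obtain ⟨a, γ, h1, h2, -, rfl⟩ := h
    exact isGoodPath_segment h1 h2
  | bd ξ =>
    obtain ⟨γ, -, rfl⟩ := h
    exact isGoodPath_ray γ

theorem isPathTo_ray (γ : S.Ray O) :
    (bd (S.toBoundary O γ) : S.Bordification O).IsPathTo (Set.univ, γ.toFun) :=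
  ⟨γ, rfl, rfl⟩

theorem exists_isPathTo_pt (S : CoarselyConvexSpace X) (O x : X) :
    ∃ a γ, (a, γ) ∈ S.L ∧ γ 0 = O ∧ γ a = x ∧
      (pt x : S.Bordification O).IsPathTo (Set.Iic a, γ) := by
  obtain ⟨a, γ, h, h0, h1⟩ := S.connected O x
  exact ⟨a, γ, h, h0, h1, a, γ, h, h0, h1, rfl⟩

/-- The threshold in `Near` is designed for this: a segment of length `a` reaches at most distance
`lam * a + k`, so its length exceeds `2 θ(0)` if its endpoint is not near. -/
theorem IsPathTo.mem_arcs (h : p.IsPathTo α) (hp : ¬ p.Near) : α ∈ p.arcs := by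
  cases p with
  | pt x =>
    obtain ⟨a, γ, h1, h2, h3, rfl⟩ := h
    refine ⟨a, γ, h1, ?_, h2, h3, rfl⟩
    have h4 := (S.quasiGeodesic a γ h1 0 a zero_le le_rfl).2
    have h5 : 2 * S.lam * S.θ 0 + S.k < dist O x := not_le.1 hp
    rw [h2, h3, NNReal.coe_zero, zero_sub, abs_neg, NNReal.abs_eq] at h4
    have h6 : S.lam * (2 * S.θ 0) < S.lam * a := by linarith
    exact_mod_cast (lt_of_mul_lt_mul_left h6 S.lam_pos.le).le
  | bd ξ => exact h

/-- If a path from `O` to `p` is long, then `p` is far away from `O`. -/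
theorem exists_not_near (S : CoarselyConvexSpace X) :
    ∃ M : ℕ, ∀ (O : X) (p : S.Bordification O) (α : Set ℝ≥0 × (ℝ≥0 → X)), p.IsPathTo α →
      ∀ t ∈ α.1, (M : ℝ≥0) ≤ t → ¬ p.Near := by
  obtain ⟨M, hM⟩ := exists_nat_gt (S.lam * (2 * S.lam * S.θ 0 + S.k + S.k₁))
  refine ⟨M, fun O p α h t ht hMt => ?_⟩
  cases p with
  | pt x =>
    obtain ⟨a, γ, h1, h2, h3, rfl⟩ := h
    have h4 := (isGoodPath_segment h1 h2).le_dist (Set.mem_Iic.2 zero_le)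
      (Set.mem_Iic.2 le_rfl)
    simp only [h2, h3, NNReal.coe_zero, zero_sub, abs_neg, NNReal.abs_eq] at h4
    have h5 : (M : ℝ) ≤ a := by exact_mod_cast hMt.trans ht
    have h6 : 2 * S.lam * S.θ 0 + S.k + S.k₁ < S.lam⁻¹ * a := by
      rw [inv_mul_eq_div, lt_div_iff₀ S.lam_pos]
      linarith
    exact not_le.2 (by linarith : 2 * S.lam * S.θ 0 + S.k < dist O x)
  | bd ξ => exact id

end Bordification

/-! ### The product on the bordification. -/

open Bordification

variable {p q : S.Bordification O}

theorem arcProd_comm (α β : Set ℝ≥0 × (ℝ≥0 → X)) : S.arcProd α β = S.arcProd β α := by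
  simp only [arcProd, Set.inter_comm, dist_comm]

theorem gromovProd_comm (p q : S.Bordification O) : gromovProd p q = gromovProd q p := by
  by_cases h : p.Near ∨ q.Near
  · rw [gromovProd, gromovProd, if_pos h, if_pos h.symm]
  · rw [gromovProd, gromovProd, if_neg h, if_neg (mt Or.symm h), iSup₂_comm]
    exact iSup_congr fun β => iSup_congr fun _ => iSup_congr fun α => iSup_congr fun _ => arcProd_comm α β

theorem exists_of_lt_gromovProd {N : ℕ} (h : (N : ℝ≥0∞) < gromovProd p q) :
    ∃ α β, p.IsPathTo α ∧ q.IsPathTo β ∧ ∃ t ∈ α.1, t ∈ β.1 ∧ (N : ℝ≥0) ≤ t ∧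
      dist (α.2 t) (β.2 t) ≤ 2 * S.D + 2 := by
  unfold gromovProd at h
  split_ifs at h
  · simp at h
  simp only [arcProd, lt_iSup_iff] at h
  obtain ⟨α, hα, β, hβ, t, ⟨⟨h1, h2⟩, h3⟩, h4⟩ := h
  exact ⟨α, β, isPathTo_of_mem_arcs hα, isPathTo_of_mem_arcs hβ, t, h1, h2,
    by exact_mod_cast h4.le, h3⟩

variable (S) in
-- Coarse converse of `exists_of_lt_gromovProd`: to bound a product below it suffices to exhibit two
-- paths that are close at large, possibly different, times.
theorem exists_lt_gromovProd (R : ℝ) (N : ℕ) :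
    ∃ M : ℕ, ∀ (O : X) (p q : S.Bordification O) (α β : Set ℝ≥0 × (ℝ≥0 → X)),
      p.IsPathTo α → q.IsPathTo β → ∀ t ∈ α.1, ∀ s ∈ β.1, dist (α.2 t) (β.2 s) ≤ R →
        (M : ℝ≥0) ≤ t → (M : ℝ≥0) ≤ s → (N : ℝ≥0∞) < gromovProd p q := by
  obtain ⟨M₁, h₁⟩ := exists_not_near S
  obtain ⟨M₂, h₂⟩ := S.exists_lt_arcProd R N
  refine ⟨max M₁ M₂, fun O p q α β hα hβ t ht s hs hR hMt hMs => ?_⟩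
  rw [Nat.cast_max, max_le_iff] at hMt hMs
  have hp := h₁ O p α hα t ht hMt.1
  have hq := h₁ O q β hβ s hs hMs.1
  rw [gromovProd, if_neg (by tauto)]
  refine (h₂ O α β hα.isGoodPath hβ.isGoodPath t ht s hs hR hMt.2 hMs.2).trans_le ?_
  exact le_iSup₂_of_le α (hα.mem_arcs hp) (le_iSup₂_of_le β (hβ.mem_arcs hq) le_rfl)

theorem toBoundary_eq_iff {γ η : S.Ray O} :
    S.toBoundary O γ = S.toBoundary O η ↔ ∃ M : ℝ, ∀ t, dist (γ t) (η t) ≤ M := by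
  exact Quotient.eq.trans (bddAbove_def.trans (exists_congr fun _ => Set.forall_mem_range))

theorem toBoundary_eq_of_dist_le {γ η : S.Ray O} (R : ℝ)
    (h : ∀ N : ℕ, ∃ t : ℝ≥0, (N : ℝ≥0) ≤ t ∧ dist (γ t) (η t) ≤ R) :
    S.toBoundary O γ = S.toBoundary O η := by
  refine toBoundary_eq_iff.2 ⟨S.E * R + S.D, fun u => ?_⟩
  obtain ⟨N, hN⟩ := exists_nat_ge u
  obtain ⟨t, ht, h⟩ := h N
  have := (isGoodPath_ray γ).dist_le_mul_add (isGoodPath_ray η) (Set.mem_univ t) (Set.mem_univ t)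
    (hN.trans ht)
  exact this.trans (by have := mul_le_mul_of_nonneg_left h S.E_pos.le; simpa using this)

/-- The bound does not depend on the rays: comparing them at time `n * u` and scaling by `1 / n`
reduces the contribution of any finite `M` to at most 1. -/
theorem dist_le_of_toBoundary_eq {γ η : S.Ray O} (h : S.toBoundary O γ = S.toBoundary O η)
    (u : ℝ≥0) : dist (γ u) (η u) ≤ S.D + 1 := by
  obtain ⟨M, hM⟩ := toBoundary_eq_iff.1 h
  obtain ⟨n, hn⟩ := exists_nat_ge (max 1 (S.E * M))
  have hn0 : (0 : ℝ) < n := lt_of_lt_of_le one_pos ((le_max_left _ _).trans hn)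
  have hn0' : (n : ℝ≥0) ≠ 0 := by exact_mod_cast hn0.ne'
  have hn1 : (1 : ℝ≥0) ≤ n := by exact_mod_cast (le_max_left _ _).trans hn
  have h1 := (isGoodPath_ray γ).dist_mul_le (isGoodPath_ray η) (Set.mem_univ (n * u))
    (Set.mem_univ (n * u)) (inv_le_one_of_one_le₀ hn1)
  simp only [inv_mul_cancel_left₀ hn0'] at h1
  have h2 : ((n : ℝ)⁻¹ * (S.E * M)) ≤ 1 := by
    rw [inv_mul_eq_div, div_le_one hn0]
    exact (le_max_right _ _).trans hn
  have h3 := mul_le_mul_of_nonneg_left (hM (n * u))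
    (by have := S.E_pos; positivity : 0 ≤ (n : ℝ)⁻¹ * S.E)
  push_cast at h1
  linarith

variable (S) in
-- Coarse uniqueness of paths to a given point, which makes the choice of paths in the supremum
-- harmless.
theorem exists_dist_le_of_isPathTo :
    ∃ K : ℝ, ∀ (O : X) (p : S.Bordification O) (α β : Set ℝ≥0 × (ℝ≥0 → X)),
      p.IsPathTo α → p.IsPathTo β → ∀ u ∈ α.1, u ∈ β.1 → dist (α.2 u) (β.2 u) ≤ K := by
  obtain ⟨K, hK⟩ := S.exists_fellow_travel_bound 0
  refine ⟨max K (S.D + 1), fun O p α β hα hβ u hu hu' => ?_⟩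
  cases p with
  | pt x =>
    obtain ⟨a, γ, h1, h2, h3, rfl⟩ := hα
    obtain ⟨b, η, h1', h2', h3', rfl⟩ := hβ
    exact (hK O _ _ (isGoodPath_segment h1 h2) (isGoodPath_segment h1' h2') a
      (Set.mem_Iic.2 le_rfl) b (Set.mem_Iic.2 le_rfl) (by simp [h3, h3']) u hu hu').trans
      (le_max_left _ _)
  | bd ξ =>
    obtain ⟨γ, h1, rfl⟩ := hα
    obtain ⟨η, h2, rfl⟩ := hβ
    exact (dist_le_of_toBoundary_eq (h1.trans h2.symm) u).trans (le_max_right _ _)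

variable (S) in
/-- The product satisfies a coarse ultrametric inequality. -/
theorem exists_lt_gromovProd_trans (N : ℕ) :
    ∃ M : ℕ, ∀ (O : X) (p q r : S.Bordification O), (M : ℝ≥0∞) < gromovProd p q →
      (M : ℝ≥0∞) < gromovProd q r → (N : ℝ≥0∞) < gromovProd p r := by
  obtain ⟨K, hK⟩ := S.exists_dist_le_of_isPathTo
  -- At time `M` the chain `α, β, β', γ` has gaps `B`, `K`, `B`; the middle one compares two paths
  -- to `q`.
  set B := S.E * (2 * S.D + 2) + S.D with hB
  obtain ⟨M, hM⟩ := S.exists_lt_gromovProd (B + K + B) N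
  refine ⟨M, fun O p q r hpq hqr => ?_⟩
  obtain ⟨α, β, hα, hβ, t, ht, ht', hMt, hd⟩ := exists_of_lt_gromovProd hpq
  obtain ⟨β', γ, hβ', hγ, s, hs, hs', hMs, hd'⟩ := exists_of_lt_gromovProd hqr
  have m1 := hα.isGoodPath.isLowerSet hMt ht
  have m2 := hβ.isGoodPath.isLowerSet hMt ht'
  have m3 := hβ'.isGoodPath.isLowerSet hMs hs
  have m4 := hγ.isGoodPath.isLowerSet hMs hs'
  refine hM O p r α γ hα hγ M m1 M m4 ?_ le_rfl le_rfl
  have d1 := hα.isGoodPath.dist_le_mul_add hβ.isGoodPath ht ht' hMt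
  have d2 := hβ'.isGoodPath.dist_le_mul_add hγ.isGoodPath hs hs' hMs
  have d3 := hK O q β β' hβ hβ' M m2 m3
  have d4 := dist_triangle4 (α.2 M) (β.2 M) (β'.2 M) (γ.2 M)
  have d5 := mul_le_mul_of_nonneg_left hd S.E_pos.le
  have d6 := mul_le_mul_of_nonneg_left hd' S.E_pos.le
  linarith

variable (S) in
/-- Moving a point of `X` by a bounded distance keeps large products large. -/
theorem exists_lt_gromovProd_of_dist_le (R : ℝ) (N : ℕ) :
    ∃ M : ℕ, ∀ (O : X) (p : S.Bordification O) (x y : X), dist x y ≤ R →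
      (M : ℝ≥0∞) < gromovProd p (.pt x) → (N : ℝ≥0∞) < gromovProd p (.pt y) := by
  obtain ⟨K, hK⟩ := S.exists_dist_le_of_isPathTo
  obtain ⟨K', hK'⟩ := S.exists_fellow_travel_bound R
  set B := S.E * (2 * S.D + 2) + S.D with hB
  obtain ⟨M, hM⟩ := S.exists_lt_gromovProd (B + K') N
  -- Segments to `x` and `y` differ in length by at most `e`, so the one to `y` still reaches time
  -- `M`.
  obtain ⟨e, he⟩ := exists_nat_ge (S.θ (R.toNNReal + 1) + 1 : ℝ)
  refine ⟨M + e, fun O p x y hxy h => ?_⟩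
  obtain ⟨α, β, hα, hβ, t, ht, ht', hMt, hd⟩ := exists_of_lt_gromovProd h
  obtain ⟨l, γ, -, γ0, hγl, hγ⟩ := exists_isPathTo_pt S O y
  have hβ' := hβ
  obtain ⟨a, η, h1, h2, h3, rfl⟩ := hβ'
  have hla := hβ.isGoodPath.abs_sub_le hγ.isGoodPath (Set.mem_Iic.2 le_rfl) (Set.mem_Iic.2 le_rfl)
    (R := R.toNNReal) (NNReal.le_toNNReal_of_coe_le (by simpa [h3, hγl] using hxy))
  have hta : (t : ℝ) ≤ a := ht'
  have hMt' : (M : ℝ) + e ≤ t := by exact_mod_cast hMt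
  have hMl : (M : ℝ≥0) ≤ l := by
    rw [← NNReal.coe_le_coe, NNReal.coe_natCast]
    linarith [(abs_le.1 hla).2]
  have hMt'' : (M : ℝ≥0) ≤ t := le_trans (by simp) hMt
  refine hM O p _ α _ hα hγ M (hα.isGoodPath.isLowerSet hMt'' ht) M hMl ?_ le_rfl le_rfl
  have d1 := hα.isGoodPath.dist_le_mul_add hβ.isGoodPath ht ht' hMt''
  have d2 := hK' O _ _ hβ.isGoodPath hγ.isGoodPath a (Set.mem_Iic.2 le_rfl) l
    (Set.mem_Iic.2 le_rfl) (by simpa [h3, hγl] using hxy) M (hMt''.trans ht') hMl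
  have d4 := dist_triangle (α.2 M) (η M) (γ M)
  have d5 := mul_le_mul_of_nonneg_left hd S.E_pos.le
  linarith

/-! ### The topology -/

theorem lt_gromovProd_bd_self (ξ : S.Boundary O) (N : ℕ) :
    (N : ℝ≥0∞) < gromovProd (.bd ξ : S.Bordification O) (.bd ξ) := by
  obtain ⟨M, hM⟩ := S.exists_lt_gromovProd 0 N
  induction ξ using Quotient.ind with
  | _ γ =>
    exact hM O _ _ _ _ (isPathTo_ray γ) (isPathTo_ray γ) M trivial M trivial (by simp) le_rfl le_rfl

theorem mk_mem_entourage_self (p : S.Bordification O) {n : ℕ} (hn : 0 < n) :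
    (p, p) ∈ entourage n := by
  cases p with
  | pt x => exact Or.inr ⟨x, x, rfl, by simpa using hn⟩
  | bd ξ => exact Or.inl (lt_gromovProd_bd_self ξ n)

theorem mk_bd_mem_entourage_iff {ξ : S.Boundary O} {n : ℕ} :
    ((.bd ξ, q) : S.Bordification O × S.Bordification O) ∈ entourage n ↔
      (n : ℝ≥0∞) < gromovProd (.bd ξ) q := by
  refine ⟨?_, Or.inl⟩
  rintro (h | ⟨x, y, h, -⟩)
  · exact h
  · cases congrArg Prod.fst h

/-- This is the composition axiom of a uniform structure. The factor `2 * n` serves two metric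
steps; in the mixed cases the metric step has size at most 1. -/
theorem exists_entourage_comp (n : ℕ) (hn : 0 < n) :
    ∃ m : ℕ, 0 < m ∧ ∀ p q r : S.Bordification O, (p, q) ∈ entourage m → (q, r) ∈ entourage m →
      (p, r) ∈ entourage n := by
  obtain ⟨m₁, h₁⟩ := S.exists_lt_gromovProd_trans n
  obtain ⟨m₂, h₂⟩ := S.exists_lt_gromovProd_of_dist_le 1 n
  set m := max (2 * n) (max m₁ m₂) with hm
  have hm0 : 0 < m := lt_of_lt_of_le (by omega) (le_max_left _ _)
  have hm₁ : (m₁ : ℝ≥0∞) ≤ m := by exact_mod_cast (le_max_left _ _).trans (le_max_right _ _)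
  have hm₂ : (m₂ : ℝ≥0∞) ≤ m := by exact_mod_cast (le_max_right _ _).trans (le_max_right _ _)
  have hmn : (m : ℝ)⁻¹ ≤ (n : ℝ)⁻¹ / 2 := by
    have : (2 * n : ℝ) ≤ m := by exact_mod_cast le_max_left (2 * n) (max m₁ m₂)
    have hn' : (0 : ℝ) < n := by exact_mod_cast hn
    calc (m : ℝ)⁻¹ ≤ (2 * n : ℝ)⁻¹ := inv_anti₀ (by positivity) this
      _ = (n : ℝ)⁻¹ / 2 := by rw [mul_inv]; ring
  have hm1 : (m : ℝ)⁻¹ ≤ 1 := inv_le_one_of_one_le₀ (by exact_mod_cast hm0)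
  refine ⟨m, hm0, ?_⟩
  rintro p q r (hpq | ⟨x, y, hpq, hd⟩) (hqr | ⟨y', z, hqr, hd'⟩)
  · exact Or.inl (h₁ O p q r (hm₁.trans_lt hpq) (hm₁.trans_lt hqr))
  · cases hqr
    exact Or.inl (h₂ O p y' z (hd'.le.trans hm1) (hm₂.trans_lt hpq))
  · cases hpq
    refine Or.inl ?_
    simp only [Set.mem_ofPred_eq] at hqr ⊢
    rw [gromovProd_comm] at hqr ⊢
    exact h₂ O r y x ((dist_comm _ _).trans_le (hd.le.trans hm1)) (hm₂.trans_lt hqr)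
  · cases hpq
    cases hqr
    exact Or.inr ⟨x, z, rfl, by linarith [dist_triangle x y z]⟩

theorem mem_nhds_iff_entourage {s : Set (S.Bordification O)} :
    s ∈ 𝓝 p ↔ ∃ n : ℕ, 0 < n ∧ ∀ q, (p, q) ∈ entourage n → q ∈ s := by
  constructor
  · intro h
    obtain ⟨U, hUs, hU, hp⟩ := mem_nhds_iff.1 h
    obtain ⟨n, hn, h⟩ := hU p hp
    exact ⟨n, hn, fun q hq => hUs (h q hq)⟩
  · rintro h
    -- The points having some `V_n`-neighbourhood inside `s` form an open set because entourages can
    -- be halved.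
    refine mem_nhds_iff.2 ⟨{q | ∃ n : ℕ, 0 < n ∧ ∀ r, (q, r) ∈ entourage n → r ∈ s}, ?_, ?_, h⟩
    · rintro q ⟨n, hn, h⟩
      exact h q (mk_mem_entourage_self q hn)
    · rintro q ⟨n, hn, h⟩
      obtain ⟨m, hm, h'⟩ := exists_entourage_comp (S := S) (O := O) n hn
      exact ⟨m, hm, fun r hr => ⟨m, hm, fun v hv => h v (h' q r v hr hv)⟩⟩

theorem hasBasis_nhds_bd (ξ : S.Boundary O) :
    (𝓝 (.bd ξ : S.Bordification O)).HasBasis (fun _ : ℕ => True)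
      fun n => {q | (n : ℝ≥0∞) < gromovProd (.bd ξ) q} := by
  refine ⟨fun s => mem_nhds_iff_entourage.trans ⟨?_, ?_⟩⟩
  · rintro ⟨n, -, h⟩
    exact ⟨n, trivial, fun q hq => h q (Or.inl hq)⟩
  · rintro ⟨n, -, h⟩
    -- Index 0 is allowed in this basis but not in the definition of the topology.
    refine ⟨n + 1, n.succ_pos, fun q hq => h ?_⟩
    exact lt_of_le_of_lt (by norm_cast; omega) (mk_bd_mem_entourage_iff.1 hq)

theorem hasBasis_nhds_boundary (ξ : S.Boundary O) :
    (𝓝 ξ).HasBasis (fun _ : ℕ => True)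
      fun n => {ζ | (n : ℝ≥0∞) < gromovProd (.bd ξ : S.Bordification O) (.bd ζ)} := by
  rw [nhds_induced]
  exact (hasBasis_nhds_bd ξ).comap _

theorem boundary_eq_of_lt_gromovProd {ξ ζ : S.Boundary O}
    (h : ∀ N : ℕ, (N : ℝ≥0∞) < gromovProd (.bd ξ : S.Bordification O) (.bd ζ)) : ξ = ζ := by
  obtain ⟨K, hK⟩ := S.exists_dist_le_of_isPathTo
  induction ξ using Quotient.ind with
  | _ γ =>
  induction ζ using Quotient.ind with
  | _ η =>
  refine toBoundary_eq_of_dist_le (K + (2 * S.D + 2) + K) fun N => ?_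
  obtain ⟨α, β, hα, hβ, t, ht, ht', hNt, hd⟩ := exists_of_lt_gromovProd (h N)
  refine ⟨t, hNt, ?_⟩
  have d1 := hK O _ _ _ (isPathTo_ray γ) hα t trivial ht
  have d2 := hK O _ _ _ hβ (isPathTo_ray η) t ht' trivial
  exact (dist_triangle4 _ (α.2 t) (β.2 t) _).trans (by simp only at d1 d2; linarith)

/-- Limits in the ideal boundary are unique. -/
theorem boundary_eq_of_tendsto {ι : Type*} {l : Filter ι} [l.NeBot] {u : ι → S.Bordification O}
    {ξ ζ : S.Boundary O} (h : Tendsto u l (𝓝 (.bd ξ))) (h' : Tendsto u l (𝓝 (.bd ζ))) :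
    ξ = ζ := by
  refine boundary_eq_of_lt_gromovProd fun N => ?_
  obtain ⟨M, hM⟩ := S.exists_lt_gromovProd_trans N
  obtain ⟨i, h1, h2⟩ := (((hasBasis_nhds_bd ξ).tendsto_right_iff.1 h M trivial).and
    ((hasBasis_nhds_bd ζ).tendsto_right_iff.1 h' M trivial)).exists
  refine hM O _ (u i) _ h1 ?_
  rw [gromovProd_comm]
  exact h2

end CoarselyConvexSpace

end CoarseConvex

namespace CoarseConvex

open CoarselyConvexSpace Bordification

/-! ### Limits of segments and convergence to boundary points. -/

section Limits

variable {X : Type*} [MetricSpace X] {S : CoarselyConvexSpace X} {O : X}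

/-- In a proper space, good segments from `O` of lengths tending to infinity subconverge to a
ray. -/
theorem exists_ray_of_segments [ProperSpace X] {l : ℕ → ℝ≥0} {g : ℕ → ℝ≥0 → X}
    (hl : Tendsto l atTop atTop) (hg : ∀ n, (l n, g n) ∈ S.L ∧ g n 0 = O) :
    ∃ (γ : S.Ray O) (φ : ℕ → ℕ), StrictMono φ ∧
      ∀ m : ℕ, Tendsto (fun n => g (φ n) m) atTop (𝓝 (γ m)) := by
  classical
  -- Beyond the end of the segment the value is `O`, so that every sequence lies in a fixed compact
  -- product of balls. Since the lengths tend to infinity, this does not affect the limits.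
  let u : ℕ → ℕ → X := fun n m => if (m : ℝ≥0) ≤ l n then g n m else O
  have hK : IsCompact (Set.univ.pi fun m : ℕ => Metric.closedBall O (S.lam * m + S.k)) :=
    isCompact_univ_pi fun m => isCompact_closedBall _ _
  have hu : ∀ n, u n ∈ Set.univ.pi fun m : ℕ => Metric.closedBall O (S.lam * m + S.k) := by
    intro n m _
    by_cases h : (m : ℝ≥0) ≤ l n
    · have := (S.quasiGeodesic _ _ (hg n).1 m 0 h zero_le).2
      simpa [u, h, (hg n).2] using this
    · have := mul_nonneg S.lam_pos.le (Nat.cast_nonneg (α := ℝ) m)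
      simpa [u, h] using add_nonneg this S.k_nonneg
  obtain ⟨δ, -, φ, hφ, hlim⟩ := hK.tendsto_subseq hu
  have hlφ : Tendsto (l ∘ φ) atTop atTop := hl.comp hφ.tendsto_atTop
  have hlim' : ∀ m : ℕ, Tendsto (fun n => g (φ n) m) atTop (𝓝 (δ m)) := fun m => by
    refine (tendsto_pi_nhds.1 hlim m).congr' ?_
    filter_upwards [hlφ.eventually_ge_atTop (m : ℝ≥0)] with n hn
    exact if_pos hn
  have h0 : δ 0 = O := by
    refine tendsto_nhds_unique (hlim' 0) ?_
    simp [(hg _).2]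
  exact ⟨⟨fun t => δ ⌊t⌋₊, ⟨⟨l ∘ φ, g ∘ φ, hlφ,
    fun n => ⟨(hg _).1, (hg _).2.trans (by simp [h0])⟩, fun m => by simpa using hlim' m⟩,
    fun t => by simp⟩, by simpa using h0⟩, φ, hφ, fun m => by simpa using hlim' m⟩

/-- A sequence of points staying at bounded distance from a ray, along times tending to infinity,
converges to the class of the ray. -/
theorem tendsto_toBoundary_of_dist_le {ι : Type*} {l : Filter ι} (η : S.Ray O) {x : ι → X}
    {t : ι → ℝ≥0} (ht : Tendsto t l atTop) {R : ℝ} (h : ∀ i, dist (x i) (η (t i)) ≤ R) :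
    Tendsto (fun i => (.pt (x i) : S.Bordification O)) l (𝓝 (.bd (S.toBoundary O η))) := by
  refine (hasBasis_nhds_bd _).tendsto_right_iff.2 fun N _ => ?_
  obtain ⟨M, hM⟩ := S.exists_lt_gromovProd R N
  -- A segment from `O` to `x i` has length at least `t i - e`.
  set e := S.θ (R.toNNReal + 1) + 1 with he
  filter_upwards [ht.eventually_ge_atTop (M + e)] with i hi
  obtain ⟨a, γ, -, -, h1, h2⟩ := exists_isPathTo_pt S O (x i)
  have hd : dist (γ a) (η (t i)) ≤ R := by rw [h1]; exact h i
  have h3 := h2.isGoodPath.abs_sub_le (isGoodPath_ray η) (Set.mem_Iic.2 le_rfl)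
    (Set.mem_univ (t i)) (R := R.toNNReal) (NNReal.le_toNNReal_of_coe_le hd)
  have hi' : (M + e : ℝ) ≤ t i := by exact_mod_cast hi
  have he' : (e : ℝ) = S.θ (R.toNNReal + 1) + 1 := by rw [he]; push_cast; rfl
  have hMa : (M : ℝ≥0) ≤ a := by
    rw [← NNReal.coe_le_coe, NNReal.coe_natCast]
    linarith [(abs_le.1 h3).1]
  refine hM O _ _ _ _ (isPathTo_ray η) h2 (t i) trivial a (Set.mem_Iic.2 le_rfl) ?_
    (le_self_add.trans hi) hMa
  rw [dist_comm]
  exact hd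

end Limits

variable {X Y : Type*} [MetricSpace X] [MetricSpace Y]
  {SX : CoarselyConvexSpace X} {SY : CoarselyConvexSpace Y} {a : X} {b : Y} {f : X → Y}

theorem LargeScaleLipschitz.exists_dist_le (hf : LargeScaleLipschitz f) (R : ℝ) :
    ∃ R', ∀ x x' : X, dist x x' ≤ R → dist (f x) (f x') ≤ R' := by
  obtain ⟨A, B, hA, -, h⟩ := hf
  exact ⟨A * R + B, fun x x' hx => (h x x').trans (by gcongr)⟩

theorem CoarseEmbedding.exists_dist_le (hf : CoarseEmbedding f) (R : ℝ) :
    ∃ R', ∀ x x' : X, dist (f x) (f x') ≤ R → dist x x' ≤ R' := by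
  obtain ⟨-, ψ, hψ, hψ', h⟩ := hf
  obtain ⟨M, hM⟩ := (hψ'.eventually_gt_atTop R.toNNReal).exists
  refine ⟨M, fun x x' hx => ?_⟩
  by_contra! hlt
  exact absurd ((hM.trans_le (hψ (show M ≤ nndist x x' from hlt.le))).trans_le (h x x'))
    (not_lt.2 (NNReal.le_toNNReal_of_coe_le hx))

/-- Uniform form of the sequential condition: a failure for every `M` would provide sequences
violating it. -/
theorem Visual.exists_lt_gromovProd (hf : Visual SX SY a b f) (N : ℕ) :
    ∃ M : ℕ, ∀ x y : X, (M : ℝ≥0∞) < gromovProd (S := SX) (O := a) (.pt x) (.pt y) →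
      (N : ℝ≥0∞) < gromovProd (S := SY) (O := b) (.pt (f x)) (.pt (f y)) := by
  by_contra! H
  choose x y h h' using H
  have h1 := hf.2 x y <| ENNReal.tendsto_nhds_top fun n => by
    filter_upwards [eventually_ge_atTop n] with m hm
    exact lt_of_le_of_lt (by exact_mod_cast hm) (h m)
  obtain ⟨m, hm⟩ := (ENNReal.tendsto_nhds_top_iff_nat.1 h1 N).exists
  exact (h' m).not_gt hm

/-! ### Rays and their shadows under the map. -/

section RayMap

variable {σ : ℝ≥0 → ℝ≥0} {T : ℝ} {η : SX.Ray a → SY.Ray b}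

/-- Well-definedness of the boundary map. Closeness is known only at the times `σ t`, but these are
unbounded and convexity fills in the rest. -/
theorem toBoundary_eq_of_shadow (hσ : Tendsto σ atTop atTop) (hf : LargeScaleLipschitz f)
    (hη : ∀ γ t, dist (f (γ t)) (η γ (σ t)) < T) {γ γ' : SX.Ray a}
    (h : SX.toBoundary a γ = SX.toBoundary a γ') :
    SY.toBoundary b (η γ) = SY.toBoundary b (η γ') := by
  obtain ⟨R, hR⟩ := hf.exists_dist_le (SX.D + 1)
  refine toBoundary_eq_of_dist_le (T + R + T) fun N => ?_
  obtain ⟨t, ht⟩ := (hσ.eventually_ge_atTop (N : ℝ≥0)).exists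
  refine ⟨σ t, ht, ?_⟩
  have h1 := hR _ _ (dist_le_of_toBoundary_eq h t)
  have h2 := hη γ t
  rw [dist_comm] at h2
  have h3 := dist_triangle4 (η γ (σ t)) (f (γ t)) (f (γ' t)) (η γ' (σ t))
  linarith [hη γ' t]

/-- Injectivity of the boundary map. -/
theorem toBoundary_eq_of_shadow_eq (hf : CoarseEmbedding f)
    (hη : ∀ γ t, dist (f (γ t)) (η γ (σ t)) < T) {γ γ' : SX.Ray a}
    (h : SY.toBoundary b (η γ) = SY.toBoundary b (η γ')) :
    SX.toBoundary a γ = SX.toBoundary a γ' := by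
  obtain ⟨R, hR⟩ := hf.exists_dist_le (T + (SY.D + 1) + T)
  refine toBoundary_eq_iff.2 ⟨R, fun t => hR _ _ ?_⟩
  have h1 := dist_le_of_toBoundary_eq h (σ t)
  have h2 := hη γ' t
  rw [dist_comm] at h2
  have h3 := dist_triangle4 (f (γ t)) (η γ (σ t)) (η γ' (σ t)) (f (γ' t))
  linarith [hη γ t]

variable (SX a) in
/-- If the product of the classes of two rays is large, then the rays stay close for a long
time. -/
theorem exists_ray_dist_le :
    ∃ R : ℝ, ∀ (γ γ' : SX.Ray a) (N : ℕ),
      (N : ℝ≥0∞) < gromovProd (.bd (SX.toBoundary a γ) : SX.Bordification a)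
        (.bd (SX.toBoundary a γ')) → ∀ u ≤ (N : ℝ≥0), dist (γ u) (γ' u) ≤ R := by
  obtain ⟨K, hK⟩ := SX.exists_dist_le_of_isPathTo
  refine ⟨K + (SX.E * (2 * SX.D + 2) + SX.D) + K, fun γ γ' N h u hu => ?_⟩
  obtain ⟨α, β, hα, hβ, t, ht, ht', hNt, hd⟩ := exists_of_lt_gromovProd h
  have hut := hu.trans hNt
  have d1 := hK a _ _ α (isPathTo_ray γ) hα u trivial (hα.isGoodPath.isLowerSet hut ht)
  have d2 := hK a _ β _ hβ (isPathTo_ray γ') u (hβ.isGoodPath.isLowerSet hut ht') trivial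
  have d3 := hα.isGoodPath.dist_le_mul_add hβ.isGoodPath ht ht' hut
  have d4 := mul_le_mul_of_nonneg_left hd SX.E_pos.le
  have d5 := dist_triangle4 (γ u) (α.2 u) (β.2 u) (γ' u)
  simp only at d1 d2
  linarith

/-- Continuity of the boundary map: time `M` on the rays becomes `σ M` on the shadows, which is as
large as needed. -/
theorem exists_lt_gromovProd_shadow (hσ : Tendsto σ atTop atTop) (hσ' : Monotone σ)
    (hf : LargeScaleLipschitz f) (hη : ∀ γ t, dist (f (γ t)) (η γ (σ t)) < T) (N : ℕ) :
    ∃ M : ℕ, ∀ γ γ' : SX.Ray a,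
      (M : ℝ≥0∞) < gromovProd (.bd (SX.toBoundary a γ) : SX.Bordification a)
        (.bd (SX.toBoundary a γ')) →
      (N : ℝ≥0∞) < gromovProd (.bd (SY.toBoundary b (η γ)) : SY.Bordification b)
        (.bd (SY.toBoundary b (η γ'))) := by
  obtain ⟨R, hR⟩ := exists_ray_dist_le SX a
  obtain ⟨R', hR'⟩ := hf.exists_dist_le R
  obtain ⟨K, hK⟩ := SY.exists_lt_gromovProd (T + R' + T) N
  obtain ⟨t, ht⟩ := (hσ.eventually_ge_atTop (K : ℝ≥0)).exists
  obtain ⟨M, hM⟩ := exists_nat_ge t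
  refine ⟨M, fun γ γ' h => ?_⟩
  have hKM : (K : ℝ≥0) ≤ σ M := ht.trans (hσ' hM)
  refine hK b _ _ _ _ (isPathTo_ray _) (isPathTo_ray _) (σ M) trivial (σ M) trivial ?_ hKM hKM
  have h1 := hR' _ _ (hR γ γ' M h M le_rfl)
  have h2 := hη γ M
  rw [dist_comm] at h2
  have h3 := dist_triangle4 (η γ (σ M)) (f (γ M)) (f (γ' M)) (η γ' (σ M))
  linarith [hη γ' M]

/-- Continuity of the inverse: as `σ M ≤ M`, shadows that are close up to time `M` are close at `σ
M`, and `f` reflects this closeness to time `M` on the rays. -/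
theorem exists_lt_gromovProd_of_shadow (hσ : ∀ t, σ t ≤ t) (hf : CoarseEmbedding f)
    (hη : ∀ γ t, dist (f (γ t)) (η γ (σ t)) < T) (N : ℕ) :
    ∃ M : ℕ, ∀ γ γ' : SX.Ray a,
      (M : ℝ≥0∞) < gromovProd (.bd (SY.toBoundary b (η γ)) : SY.Bordification b)
        (.bd (SY.toBoundary b (η γ'))) →
      (N : ℝ≥0∞) < gromovProd (.bd (SX.toBoundary a γ) : SX.Bordification a)
        (.bd (SX.toBoundary a γ')) := by
  obtain ⟨R, hR⟩ := exists_ray_dist_le SY b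
  obtain ⟨R', hR'⟩ := hf.exists_dist_le (T + R + T)
  obtain ⟨M, hM⟩ := SX.exists_lt_gromovProd R' N
  refine ⟨M, fun γ γ' h => ?_⟩
  refine hM a _ _ _ _ (isPathTo_ray _) (isPathTo_ray _) M trivial M trivial ?_ le_rfl le_rfl
  refine hR' _ _ ?_
  have h1 := hR (η γ) (η γ') M h (σ M) (hσ M)
  have h2 := hη γ' M
  rw [dist_comm] at h2
  have h3 := dist_triangle4 (f (γ M)) (η γ (σ M)) (η γ' (σ M)) (f (γ' M))
  linarith [hη γ M]

/-- Every ray in the target of a coarsely surjective visual map is the limit of the image of a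
ray. -/
theorem exists_ray_shadow_eq [ProperSpace X] (hσ : Tendsto σ atTop atTop)
    (hvis : Visual SX SY a b f) (hf : CoarselySurjective f)
    (hη : ∀ γ t, dist (f (γ t)) (η γ (σ t)) < T) (ζ : SY.Ray b) :
    ∃ γ, SY.toBoundary b (η γ) = SY.toBoundary b ζ := by
  obtain ⟨C₀, -, hC⟩ := hf
  choose x hx using fun n : ℕ => hC (ζ n)
  choose l g hg g0 gl hp using fun n => exists_isPathTo_pt SX a (x n)
  have hl : Tendsto l atTop atTop := by
    obtain ⟨A, B, hA, hB, hAB⟩ := hvis.1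
    have hA0 : 0 < A := one_pos.trans_le hA
    have hlam := SX.lam_pos
    -- The distance from `b` to `ζ n` grows linearly in `n`, while it is bounded by an affine
    -- function of `l n`; hence `l` tends to infinity.
    have hbd : ∀ n : ℕ, SY.lam⁻¹ * n ≤
        SY.k₁ + dist b (f a) + (A * (SX.lam * l n + SX.k) + B) + C₀ := by
      intro n
      have h1 := (isGoodPath_ray ζ).le_dist (Set.mem_univ 0) (Set.mem_univ (n : ℝ≥0))
      simp only [ζ.base, NNReal.coe_zero, zero_sub, abs_neg, NNReal.coe_natCast,
        Nat.abs_cast] at h1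
      have h2 := (SX.quasiGeodesic _ _ (hg n) 0 (l n) zero_le le_rfl).2
      rw [g0, gl, NNReal.coe_zero, zero_sub, abs_neg, NNReal.abs_eq] at h2
      have h3 := dist_triangle4 b (f a) (f (x n)) (ζ n)
      have h4 := mul_le_mul_of_nonneg_left h2 hA0.le
      linarith [hAB a (x n), hx n]
    refine tendsto_atTop.2 fun M => ?_
    have hlin : Tendsto (fun n : ℕ => SY.lam⁻¹ * (n : ℝ)) atTop atTop :=
      tendsto_natCast_atTop_atTop.const_mul_atTop (inv_pos.2 SY.lam_pos)
    filter_upwards [hlin.eventually_gt_atTop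
      (SY.k₁ + dist b (f a) + (A * (SX.lam * M + SX.k) + B) + C₀)] with n hn
    by_contra! hlt
    have : (l n : ℝ) ≤ M := hlt.le
    have : A * (SX.lam * l n + SX.k) ≤ A * (SX.lam * M + SX.k) := by gcongr
    linarith [hbd n]
  obtain ⟨γ, φ, hφ, hγ⟩ := exists_ray_of_segments hl fun n => ⟨hg n, g0 n⟩
  refine ⟨γ, boundary_eq_of_lt_gromovProd fun N => ?_⟩
  -- The chain in `Y` runs from `[η γ]` through `f (γ m)` and `f (x n)` to `[ζ]`. Its middle link
  -- passes from `f (g n m)` to `f (γ m)`, which are at bounded distance.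
  obtain ⟨N₁, hN₁⟩ := SY.exists_lt_gromovProd_trans N
  obtain ⟨N₂, hN₂⟩ := SY.exists_lt_gromovProd_trans N₁
  obtain ⟨R, hR⟩ := hvis.1.exists_dist_le 1
  obtain ⟨N₃, hN₃⟩ := SY.exists_lt_gromovProd_of_dist_le R N₂
  obtain ⟨N₄, hN₄⟩ := hvis.exists_lt_gromovProd N₃
  obtain ⟨N₅, hN₅⟩ := SX.exists_lt_gromovProd 1 N₄
  have hγlim : Tendsto (fun m : ℕ => (.pt (f (γ m)) : SY.Bordification b)) atTop
      (𝓝 (.bd (SY.toBoundary b (η γ)))) :=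
    tendsto_toBoundary_of_dist_le _ (hσ.comp tendsto_natCast_atTop_atTop) fun m => (hη γ m).le
  have hxlim : Tendsto (fun n : ℕ => (.pt (f (x n)) : SY.Bordification b)) atTop
      (𝓝 (.bd (SY.toBoundary b ζ))) :=
    tendsto_toBoundary_of_dist_le _ tendsto_natCast_atTop_atTop hx
  obtain ⟨e, he⟩ := exists_nat_ge (SX.θ (0 + 1) + 1 : ℝ)
  -- The time `m` is fixed before the index `i`, since how far out `i` must be depends on `m`.
  obtain ⟨m, hm, hmγ⟩ := ((eventually_ge_atTop (N₅ + e)).and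
    ((hasBasis_nhds_bd _).tendsto_right_iff.1 hγlim N₁ trivial)).exists
  obtain ⟨i, hi, hil, hiζ⟩ := ((Metric.tendsto_nhds.1 (hγ m) 1 one_pos).and
    (((hl.comp hφ.tendsto_atTop).eventually_ge_atTop (m : ℝ≥0)).and
    ((hasBasis_nhds_bd _).tendsto_right_iff.1 (hxlim.comp hφ.tendsto_atTop) N₂ trivial))).exists
  set n := φ i
  -- The initial part of `g n` need not belong to `L`, so a good segment to `g n m` is chosen
  -- afresh; its length is within `e` of `m`.
  obtain ⟨l', h, -, -, hl', hh⟩ := exists_isPathTo_pt SX a (g n m)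
  have hmem : (m : ℝ≥0) ∈ Set.Iic (l n) := hil
  have hll := (hp n).isGoodPath.abs_sub_le hh.isGoodPath hmem (Set.mem_Iic.2 le_rfl) (R := 0)
    (by simp [hl'])
  have hN₅m : (N₅ : ℝ≥0) ≤ m := by exact_mod_cast (Nat.le_add_right _ _).trans hm
  have hN₅l' : (N₅ : ℝ≥0) ≤ l' := by
    have : (N₅ + e : ℝ) ≤ m := by exact_mod_cast hm
    rw [NNReal.coe_natCast] at hll
    rw [← NNReal.coe_le_coe, NNReal.coe_natCast]
    linarith [(abs_le.1 hll).2]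
  have h1 : (N₄ : ℝ≥0∞) < gromovProd (S := SX) (O := a) (.pt (x n)) (.pt (g n m)) :=
    hN₅ a _ _ _ _ (hp n) hh m hmem l' (Set.mem_Iic.2 le_rfl) (by simp [hl']) hN₅m hN₅l'
  have h2 := hN₃ b _ _ _ (hR _ _ hi.le) (hN₄ _ _ h1)
  refine hN₁ b _ _ _ hmγ ?_
  rw [gromovProd_comm]
  exact hN₂ b _ _ _ hiζ h2

end RayMap

end CoarseConvex

open CoarseConvex CoarselyConvexSpace in
theorem corollary5 {X Y : Type*} [MetricSpace X] [MetricSpace Y] [ProperSpace X] [ProperSpace Y]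
    (SX : CoarseConvex.CoarselyConvexSpace X) (SY : CoarseConvex.CoarselyConvexSpace Y)
    (a : X) (b : Y) (f : X → Y)
    (hvis : CoarseConvex.Visual SX SY a b f)
    (σ : ℝ≥0 → ℝ≥0) (hσ : CoarseConvex.RoughContraction σ) (T : ℝ) (hT : 0 < T)
    (hequiv : CoarseConvex.RayEquivariant SX SY a b σ T f)
    (hemb : CoarseConvex.CoarseEmbedding f) :
    ∃ F : SX.Boundary a → SY.Boundary b,
      CoarseConvex.IsInducedBy SX SY a b f F ∧
      (∀ G, CoarseConvex.IsInducedBy SX SY a b f G → G = F) ∧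
      IsEmbedding F ∧
      (CoarseConvex.CoarselySurjective f → IsHomeomorph F) := by
  obtain ⟨τ, -, -, hσ_top, hσ_le, -, hσ_mono⟩ := hσ
  choose η hη using hequiv.2
  let F : SX.Boundary a → SY.Boundary b := Quotient.lift (fun γ => SY.toBoundary b (η γ))
    fun γ γ' h => toBoundary_eq_of_shadow hσ_top hvis.1 hη (Quotient.sound h)
  have hF : IsInducedBy SX SY a b f F := fun γ =>
    tendsto_toBoundary_of_dist_le _ (hσ_top.comp tendsto_natCast_atTop_atTop)
      fun n => (hη γ n).le
  have hFe : IsEmbedding F := by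
    refine ⟨isInducing_iff_nhds.2 fun ξ => ?_, fun ξ ζ h => ?_⟩
    -- Both neighbourhood filters have bases of product level sets; the first inclusion is
    -- continuity of the inverse, the second continuity of `F`.
    · refine (hasBasis_nhds_boundary ξ).ext ((hasBasis_nhds_boundary (F ξ)).comap F) ?_ ?_
      · intro N _
        obtain ⟨M, hM⟩ := exists_lt_gromovProd_of_shadow hσ_le hemb hη N
        refine ⟨M, trivial, fun ζ hζ => ?_⟩
        induction ξ using Quotient.ind with
        | _ γ =>
        induction ζ using Quotient.ind with
        | _ γ' => exact hM γ γ' hζ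
      · intro N _
        obtain ⟨M, hM⟩ := exists_lt_gromovProd_shadow hσ_top hσ_mono hvis.1 hη N
        refine ⟨M, trivial, fun ζ hζ => ?_⟩
        induction ξ using Quotient.ind with
        | _ γ =>
        induction ζ using Quotient.ind with
        | _ γ' => exact hM γ γ' hζ
    · induction ξ using Quotient.ind with
      | _ γ =>
      induction ζ using Quotient.ind with
      | _ γ' => exact toBoundary_eq_of_shadow_eq hemb hη h
  refine ⟨F, hF, fun G hG => funext fun ξ => ?_, hFe, fun hsurj => ?_⟩
  · induction ξ using Quotient.ind with
    | _ γ => exact boundary_eq_of_tendsto (hG γ) (hF γ)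
  · refine isHomeomorph_iff_isEmbedding_surjective.2 ⟨hFe, fun ξ => ?_⟩
    induction ξ using Quotient.ind with
    | _ ζ =>
      obtain ⟨γ, hγ⟩ := exists_ray_shadow_eq hσ_top hvis hsurj hη ζ
      exact ⟨SX.toBoundary a γ, hγ⟩
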